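/- **Theorem.** Let $X,Y$ be finite nonempty sets, let $f:X\times Y\to\{-1,+1\}$, and let $0\le\epsilon<1/2$. All logarithms are to base $2$. *Spectrum and entropy.* Let $R_f$ be the $X\times Y$ matrix with entries $(R_f)_{xy}=f(x,y)$, and let $\sigma(f)=(\lambda_i)_i$ be the list of eigenvalues, with multiplicity, of $\frac{1}{|X||Y|}R_fR_f^T$. For $1<\beta<\infty$ let $S_\beta(\sigma(f))=\frac{1}{1-\beta}\log\sum_i\lambda_i^\beta$, and let $S_\infty(\sigma(f))=-\log\max_i\lambda_i$. *Complexity.* Consider two-party quantum protocols in which Alice receives $x\in X$, Bob receives $y\in Y$, and they initially share a maximally entangled state $|\Phi^k\rangle=\frac{1}{\sqrt k}\sum_{j=1}^k|j\rangle|j\rangle$ of some rank $k\ge1$. In each move one of the parties applies to its own register an isometry that may depend on its own input (that is, it attaches a fresh finite-dimensional ancilla and applies a unitary), and then either sends one qubit to the other party, or ends the protocol by measuring its register and announcing a sign that is a function of the outcome. The order of the moves is fixed by the protocol and otherwise arbitrary; the cost is the number of qubits sent. Let $Q^{(*)}_\epsilon(f)$ be the minimum cost of such a protocol that, on every input $(x,y)$,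 announces $f(x,y)$ with probability at least $1-\epsilon$. Let $Q^{(*),\mathrm{unif}}_\epsilon(f)$ be the minimum cost of such a protocol whose success probability, averaged over inputs $(x,y)$ drawn from the uniform distribution $\mu(x,y)=\frac1{|X||Y|}$, is at least $1-\epsilon$. Then for every real $\beta>1$ $$Q^{(*)}_\epsilon(f)\ \ge\ \tfrac12 S_\beta(\sigma(f))+\tfrac{\beta}{\beta-1}\log(1-2\epsilon),$$ and the inequality also holds for $\beta=\infty$, with $\frac{\beta}{\beta-1}$ read as $1$. The same lower bounds hold for $Q^{(*),\mathrm{unif}}_\epsilon(f)$. -/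

import Mathlib

noncomputable section

namespace QuantumCC

/-! ### Two-party quantum protocols

A joint pure state of Alice's register (basis `Fin a`) and Bob's register (basis `Fin b`) is
written as its matrix of amplitudes `Ψ : Matrix (Fin a) (Fin b) ℂ`, that is,
`|Ψ⟩ = ∑ i j, Ψ i j |i⟩|j⟩`.  An operator `V` on Alice's side acts as `Ψ ↦ V * Ψ`, an operator `W`
on Bob's side as `Ψ ↦ Ψ * Wᵀ`. -/

/-- `V` is an isometry from the space with basis `m` to the space with basis `n`. -/
def IsIsometry {m n : Type*} [Fintype n] [DecidableEq m] (V : Matrix n m ℂ) : Prop :=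
  V.conjTranspose * V = 1

/-- Quantum communication protocols between Alice, whose input is in `X`, and Bob, whose input is
in `Y`, when their current registers have dimensions `a` and `b`.

In every move one of the parties applies to its own register an isometry that may depend on its
own input (that is: it attaches a fresh ancilla of any dimension and applies a unitary; a register
to be discarded is left untouched from then on, so that local channels and measurements are
covered), and then either passes one qubit of its register to the other party, or ends the protocol
by measuring its register in the computational basis and announcing a sign computed from the
outcome.  The order of the senders is arbitrary, and messages of several qubits are sent
qubit by qubit. -/
inductive Protocol (X : Type*) (Y : Type*) : ℕ → ℕ → Type _
  | aliceSend {a b : ℕ} (a' : ℕ) (V : X → Matrix (Fin a' × Fin 2) (Fin a) ℂ)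
      (hV : ∀ x, IsIsometry (V x)) (next : Protocol X Y a' (b * 2)) : Protocol X Y a b
  | bobSend {a b : ℕ} (b' : ℕ) (W : Y → Matrix (Fin b' × Fin 2) (Fin b) ℂ)
      (hW : ∀ y, IsIsometry (W y)) (next : Protocol X Y (a * 2) b') : Protocol X Y a b
  | aliceOutput {a b : ℕ} (a' : ℕ) (V : X → Matrix (Fin a') (Fin a) ℂ)
      (hV : ∀ x, IsIsometry (V x)) (g : Fin a' → ℤˣ) : Protocol X Y a b
  | bobOutput {a b : ℕ} (b' : ℕ) (W : Y → Matrix (Fin b') (Fin b) ℂ)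
      (hW : ∀ y, IsIsometry (W y)) (g : Fin b' → ℤˣ) : Protocol X Y a b

/-- A qubit changes hands from Alice to Bob: the amplitudes are unchanged. -/
def passToBob {a b : ℕ} (Ψ : Matrix (Fin a × Fin 2) (Fin b) ℂ) :
    Matrix (Fin a) (Fin (b * 2)) ℂ :=
  fun i j => Ψ (i, (finProdFinEquiv.symm j).2) (finProdFinEquiv.symm j).1

/-- A qubit changes hands from Bob to Alice: the amplitudes are unchanged. -/
def passToAlice {a b : ℕ} (Ψ : Matrix (Fin a) (Fin b × Fin 2) ℂ) :
    Matrix (Fin (a * 2)) (Fin b) ℂ :=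
  fun i j => Ψ (finProdFinEquiv.symm i).1 (j, (finProdFinEquiv.symm i).2)

namespace Protocol

variable {X Y : Type*}

/-- The number of qubits that the two parties exchange. -/
def cost : {a b : ℕ} → Protocol X Y a b → ℕ
  | _, _, aliceSend _ _ _ next => next.cost + 1
  | _, _, bobSend _ _ _ next => next.cost + 1
  | _, _, aliceOutput _ _ _ _ => 0
  | _, _, bobOutput _ _ _ _ => 0

/-- The probability that the protocol announces `s` on the input `(x, y)`, when it is started in
the joint state `Ψ`. -/
def outputProb (x : X) (y : Y) (s : ℤˣ) :
    {a b : ℕ} → Protocol X Y a b → Matrix (Fin a) (Fin b) ℂ → ℝ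
  | _, _, aliceSend _ V _ next, Ψ => next.outputProb x y s (passToBob (V x * Ψ))
  | _, _, bobSend _ W _ next, Ψ => next.outputProb x y s (passToAlice (Ψ * (W y).transpose))
  | _, _, aliceOutput _ V _ g, Ψ => ∑ i, ∑ j, if g i = s then ‖(V x * Ψ) i j‖ ^ 2 else 0
  | _, _, bobOutput _ W _ g, Ψ =>
      ∑ i, ∑ j, if g j = s then ‖(Ψ * (W y).transpose) i j‖ ^ 2 else 0

end Protocol

/-- The maximally entangled state `|Φ^k⟩ = k^{-1/2} ∑_{j=1}^k |j⟩|j⟩`. -/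
def maxEntangled (k : ℕ) : Matrix (Fin k) (Fin k) ℂ :=
  ((1 / Real.sqrt k : ℝ) : ℂ) • (1 : Matrix (Fin k) (Fin k) ℂ)

/-! ### EPR-assisted communication complexity -/

section Complexity

variable {X Y : Type*}

/-- The EPR-assisted bounded-error quantum communication complexity `Q^{(*)}_ε(f)`: the least
number of qubits exchanged by a protocol that starts from a maximally entangled state of some rank
and, on every input, announces `f x y` with probability at least `1 - ε`. -/
def eprComplexity (f : X → Y → ℤˣ) (ε : ℝ) : ℕ∞ :=
  sInf {q : ℕ∞ | ∃ k : ℕ, 0 < k ∧ ∃ P : Protocol X Y k k,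
    (∀ x y, 1 - ε ≤ P.outputProb x y (f x y) (maxEntangled k)) ∧ q = (P.cost : ℕ∞)}

/-- The distributional version: the probability of success is averaged over inputs `(x, y)` drawn
with probabilities `μ x y`. -/
def eprDistComplexity [Fintype X] [Fintype Y] (μ : X → Y → ℝ) (f : X → Y → ℤˣ) (ε : ℝ) : ℕ∞ :=
  sInf {q : ℕ∞ | ∃ k : ℕ, 0 < k ∧ ∃ P : Protocol X Y k k,
    1 - ε ≤ ∑ x, ∑ y, μ x y * P.outputProb x y (f x y) (maxEntangled k) ∧ q = (P.cost : ℕ∞)}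

/-- The uniform distribution on `X × Y`. -/
def uniformInput [Fintype X] [Fintype Y] : X → Y → ℝ :=
  fun _ _ => 1 / ((Fintype.card X : ℝ) * (Fintype.card Y : ℝ))

end Complexity

/-! ### The spectrum of a function and its Rényi entropies -/

section Spectrum

variable {X Y : Type*} [Fintype X] [Fintype Y]

/-- The rectangle `R_f` of `f`. -/
def rectangle (f : X → Y → ℤˣ) : Matrix X Y ℝ :=
  Matrix.of fun x y => (((f x y : ℤˣ) : ℤ) : ℝ)

/-- The marginal density matrix `R_f R_fᵀ / (|X| |Y|)`. -/
def marginalDensity (f : X → Y → ℤˣ) : Matrix X X ℝ :=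
  (1 / ((Fintype.card X : ℝ) * (Fintype.card Y : ℝ))) • (rectangle f * (rectangle f).transpose)

theorem marginalDensity_isHermitian (f : X → Y → ℤˣ) : (marginalDensity f).IsHermitian := by
  ext i j
  simp [marginalDensity, Matrix.mul_apply, mul_comm]

/-- The eigenvalue spectrum `σ(f)`: the eigenvalues of the marginal density matrix, listed with
multiplicity. -/
def spectrumOf [DecidableEq X] (f : X → Y → ℤˣ) : X → ℝ :=
  (marginalDensity_isHermitian f).eigenvalues

end Spectrum

/-- The Rényi entropy (in bits) of finite order `α`, where `α > 0` and `α ≠ 1`, of a spectrum. -/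
def renyiEntropy {ι : Type*} [Fintype ι] (α : ℝ) (lam : ι → ℝ) : ℝ :=
  1 / (1 - α) * Real.logb 2 (∑ i, lam i ^ α)

/-- The Rényi entropy (in bits) of order `∞`: minus the logarithm of the largest eigenvalue. -/
def renyiEntropyInfty {ι : Type*} (lam : ι → ℝ) : ℝ :=
  -Real.logb 2 (⨆ i, lam i)

end QuantumCC

end

/-!
Each transmitted qubit at most doubles the `γ₂` norm of what the parties can compute. Pulled back
to the initial state, the observable measured by a protocol that exchanges `c` qubits has the form
`∑ s, (D s x)ᴴ ⊗ F s y`, where `∑ s, (D s x)ᴴ D s x` and `∑ s, (F s y)ᴴ F s y` are at most `2 ^ c`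
as operators (`Protocol.exists_operator_factorization`). The final measurement is a single
contraction on one side; passing a qubit splits each operator along the basis of the qubit on either
side of the inner product, which costs a factor `2` for each party. On a normalized initial state
the matrix `C` of expected outputs is therefore a Gram matrix `C x y = ⟨α x, γ y⟩` with
`‖α x‖², ‖γ y‖² ≤ 2 ^ c` (`Protocol.exists_gram_correlation`). This holds for any initial state,
in particular for a maximally entangled one.

The average advantage of the protocol is `⟨R_f, C⟩ / (|X| |Y|)`, and it is at least `1 - 2 ε`. In
the singular bases of `R_f` it is at most `∑ i, √(λ i) D i`, where `D i` is the absolute value of a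
diagonal entry of `C / √(|X| |Y|)`. Since `|C x y| ≤ 1`, the Frobenius norm of that matrix is at
most one, whence `∑ D i ^ 2 ≤ 1`, and the Gram representation gives `∑ D i ≤ 2 ^ c`
(`exists_weights`). Hölder's inequality then gives
`1 - 2 ε ≤ 2 ^ (c (1 - 1/β)) (∑ λ i ^ β) ^ (1 / (2 β))` (`sum_mul_sqrt_le`), and taking
logarithms yields the bound. For `β = ∞`, `∑ √(λ i) D i ≤ √(max λ) ∑ D i` suffices. The worst-case
complexity is at least the one for the uniform distribution.
-/

namespace QuantumCC
open Matrix

/-! ### Euclidean length of vectors and contractions -/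

/-- The squared Euclidean length of a vector of coordinates. -/
def lengthSq {𝕜 ι : Type*} [RCLike 𝕜] [Fintype ι] (v : ι → 𝕜) : ℝ := ∑ i, ‖v i‖ ^ 2

section Length

variable {𝕜 ι κ : Type*} [RCLike 𝕜] [Fintype ι] [Fintype κ]

theorem lengthSq_nonneg (v : ι → 𝕜) : 0 ≤ lengthSq v :=
  Finset.sum_nonneg fun _ _ => by positivity

theorem coe_lengthSq (v : ι → 𝕜) : ((lengthSq v : ℝ) : 𝕜) = star v ⬝ᵥ v := by
  simp [lengthSq, dotProduct, RCLike.conj_mul]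

theorem lengthSq_eq_re (v : ι → 𝕜) : lengthSq v = RCLike.re (star v ⬝ᵥ v) := by
  rw [← coe_lengthSq, RCLike.ofReal_re]

/-- The adjoint of a contraction is a contraction. -/
theorem lengthSq_conjTranspose_mulVec_le {V : Matrix κ ι 𝕜}
    (hV : ∀ c, lengthSq (V *ᵥ c) ≤ lengthSq c) (b : κ → 𝕜) :
    lengthSq (Vᴴ *ᵥ b) ≤ lengthSq b := by
  set c := Vᴴ *ᵥ b with hc
  have h0 := lengthSq_nonneg (b - V *ᵥ c)
  have h1 : star b ⬝ᵥ (V *ᵥ c) = star c ⬝ᵥ c := by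
    rw [dotProduct_mulVec]
    congr 1
    rw [hc, star_mulVec, conjTranspose_conjTranspose]
  have h2 : star (V *ᵥ c) ⬝ᵥ b = star c ⬝ᵥ c := by
    rw [star_mulVec, ← dotProduct_mulVec]
  have h3 : lengthSq (b - V *ᵥ c) = lengthSq b - 2 * lengthSq c + lengthSq (V *ᵥ c) := by
    simp only [lengthSq_eq_re, star_sub, sub_dotProduct, dotProduct_sub, map_sub, h1, h2]
    ring
  have h4 := hV c
  linarith

theorem sum_norm_sq_mul {ν : Type*} [Fintype ν] (V : Matrix κ ι 𝕜) (Ψ : Matrix ι ν 𝕜) :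
    ∑ i, ∑ j, ‖(V * Ψ) i j‖ ^ 2 = ∑ j, lengthSq (V *ᵥ Ψ.col j) := by
  rw [Finset.sum_comm]
  rfl

theorem sum_norm_sq_mul_transpose {ν : Type*} [Fintype ν] (W : Matrix κ ι 𝕜)
    (Ψ : Matrix ν ι 𝕜) :
    ∑ i, ∑ j, ‖(Ψ * Wᵀ) i j‖ ^ 2 = ∑ i, lengthSq (W *ᵥ Ψ i) := by
  refine Finset.sum_congr rfl fun i _ => Finset.sum_congr rfl fun j _ => ?_
  simp [mul_apply, mulVec, dotProduct, mul_comm]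

end Length

section Isometry

variable {m n p : Type*} [Fintype m] [Fintype n] [Fintype p] [DecidableEq m]

theorem IsIsometry.lengthSq_mulVec {V : Matrix n m ℂ} (hV : IsIsometry V) (v : m → ℂ) :
    lengthSq (V *ᵥ v) = lengthSq v := by
  rw [lengthSq_eq_re, lengthSq_eq_re, star_mulVec, ← dotProduct_mulVec, mulVec_mulVec,
    show Vᴴ * V = 1 from hV, one_mulVec]

theorem IsIsometry.lengthSq_conjTranspose_mulVec_le {V : Matrix n m ℂ} (hV : IsIsometry V)
    (w : n → ℂ) : lengthSq (Vᴴ *ᵥ w) ≤ lengthSq w :=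
  QuantumCC.lengthSq_conjTranspose_mulVec_le (fun c => (hV.lengthSq_mulVec c).le) w

theorem IsIsometry.sum_norm_sq_mul {V : Matrix n m ℂ} (hV : IsIsometry V) (Ψ : Matrix m p ℂ) :
    ∑ i, ∑ j, ‖(V * Ψ) i j‖ ^ 2 = ∑ i, ∑ j, ‖Ψ i j‖ ^ 2 := by
  rw [QuantumCC.sum_norm_sq_mul, Finset.sum_comm]
  exact Finset.sum_congr rfl fun j _ => hV.lengthSq_mulVec _

theorem IsIsometry.sum_norm_sq_mul_transpose {W : Matrix n m ℂ} (hW : IsIsometry W)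
    (Ψ : Matrix p m ℂ) :
    ∑ i, ∑ j, ‖(Ψ * Wᵀ) i j‖ ^ 2 = ∑ i, ∑ j, ‖Ψ i j‖ ^ 2 := by
  rw [QuantumCC.sum_norm_sq_mul_transpose]
  exact Finset.sum_congr rfl fun j _ => hW.lengthSq_mulVec _

end Isometry

/-! ### Transfer of a qubit -/

theorem sum_norm_sq_passToBob {a b : ℕ} (Ψ : Matrix (Fin a × Fin 2) (Fin b) ℂ) :
    ∑ i, ∑ j, ‖passToBob Ψ i j‖ ^ 2 = ∑ i, ∑ j, ‖Ψ i j‖ ^ 2 := by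
  rw [Fintype.sum_prod_type]
  refine Finset.sum_congr rfl fun i _ => ?_
  rw [Finset.sum_comm, ← finProdFinEquiv.sum_comp, Fintype.sum_prod_type]
  simp [passToBob]

theorem sum_norm_sq_passToAlice {a b : ℕ} (Ψ : Matrix (Fin a) (Fin b × Fin 2) ℂ) :
    ∑ i, ∑ j, ‖passToAlice Ψ i j‖ ^ 2 = ∑ i, ∑ j, ‖Ψ i j‖ ^ 2 := by
  rw [← finProdFinEquiv.sum_comp, Fintype.sum_prod_type]
  refine Finset.sum_congr rfl fun i _ => ?_
  rw [Finset.sum_comm, Fintype.sum_prod_type]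
  simp [passToAlice]

/-! ### The correlation produced by a protocol -/

namespace Protocol

variable {X Y : Type*}

/-- The two outputs have total probability one on a normalized state. -/
theorem outputProb_one_add_outputProb_neg_one (x : X) (y : Y) {a b : ℕ} (P : Protocol X Y a b)
    (Ψ : Matrix (Fin a) (Fin b) ℂ) :
    P.outputProb x y 1 Ψ + P.outputProb x y (-1) Ψ = ∑ i, ∑ j, ‖Ψ i j‖ ^ 2 := by
  have key : ∀ (s : ℤˣ) (r : ℝ), ((if s = 1 then r else 0) + if s = -1 then r else 0) = r := by
    intro s r
    rcases Int.units_eq_one_or s with rfl | rfl <;> simp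
  induction P with
  | aliceSend a' V hV next ih => rw [outputProb, outputProb, ih, sum_norm_sq_passToBob,
      (hV x).sum_norm_sq_mul]
  | bobSend b' W hW next ih => rw [outputProb, outputProb, ih, sum_norm_sq_passToAlice,
      (hW y).sum_norm_sq_mul_transpose]
  | aliceOutput a' V hV g =>
    simp only [outputProb, ← Finset.sum_add_distrib, key]
    exact (hV x).sum_norm_sq_mul Ψ
  | bobOutput b' W hW g =>
    simp only [outputProb, ← Finset.sum_add_distrib, key]
    exact (hW y).sum_norm_sq_mul_transpose Ψ

theorem outputProb_nonneg (x : X) (y : Y) (s : ℤˣ) {a b : ℕ} (P : Protocol X Y a b)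
    (Ψ : Matrix (Fin a) (Fin b) ℂ) : 0 ≤ P.outputProb x y s Ψ := by
  induction P with
  | aliceSend a' V hV next ih => exact ih _
  | bobSend b' W hW next ih => exact ih _
  | aliceOutput a' V hV g | bobOutput b' W hW g =>
    refine Finset.sum_nonneg fun i _ => Finset.sum_nonneg fun j _ => ?_
    split_ifs <;> positivity

/-- The expectation of the sign announced on the input `(x, y)`. -/
noncomputable def correlation (x : X) (y : Y) {a b : ℕ} (P : Protocol X Y a b)
    (Ψ : Matrix (Fin a) (Fin b) ℂ) : ℝ :=
  P.outputProb x y 1 Ψ - P.outputProb x y (-1) Ψ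

theorem sign_mul_correlation (x : X) (y : Y) (s : ℤˣ) {a b : ℕ} (P : Protocol X Y a b)
    {Ψ : Matrix (Fin a) (Fin b) ℂ} (hΨ : ∑ i, ∑ j, ‖Ψ i j‖ ^ 2 = 1) :
    (((s : ℤˣ) : ℤ) : ℝ) * P.correlation x y Ψ = 2 * P.outputProb x y s Ψ - 1 := by
  have h := P.outputProb_one_add_outputProb_neg_one x y Ψ
  rcases Int.units_eq_one_or s with rfl | rfl <;> simp [correlation] <;> linarith

theorem abs_correlation_le (x : X) (y : Y) {a b : ℕ} (P : Protocol X Y a b)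
    {Ψ : Matrix (Fin a) (Fin b) ℂ} (hΨ : ∑ i, ∑ j, ‖Ψ i j‖ ^ 2 = 1) :
    |P.correlation x y Ψ| ≤ 1 := by
  have h := P.outputProb_one_add_outputProb_neg_one x y Ψ
  have h1 := P.outputProb_nonneg x y 1 Ψ
  have h2 := P.outputProb_nonneg x y (-1) Ψ
  rw [correlation, abs_le]
  constructor <;> linarith

end Protocol

theorem sum_norm_sq_maxEntangled {k : ℕ} (hk : 0 < k) :
    ∑ i, ∑ j, ‖maxEntangled k i j‖ ^ 2 = 1 := by
  have hk' : (k : ℝ) ≠ 0 := by positivity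
  have h : ∀ i j : Fin k, ‖maxEntangled k i j‖ ^ 2 = if i = j then (k : ℝ)⁻¹ else 0 := by
    intro i j
    by_cases hij : i = j
    · subst hij
      simp [maxEntangled, abs_of_nonneg]
    · simp [maxEntangled, hij]
  simp [h, hk']


/-! ### Observables measured by a protocol -/

theorem trace_conjTranspose_mul {m n : Type*} [Fintype m] [Fintype n] (A B : Matrix m n ℂ) :
    (Aᴴ * B).trace = ∑ i, ∑ j, star (A i j) * B i j := by
  rw [Finset.sum_comm]
  simp [trace, mul_apply]

namespace Protocol

variable {X Y : Type*}

/-- The block with indices `u`, `v` of an operator on a register that ends in a qubit. -/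
def qubitBlock {b : ℕ} (F : Matrix (Fin (b * 2)) (Fin (b * 2)) ℂ) (u v : Fin 2) :
    Matrix (Fin b) (Fin b) ℂ :=
  F.submatrix (fun j => finProdFinEquiv (j, u)) (fun j => finProdFinEquiv (j, v))

/-- The component of an operator whose output qubit is in the basis state `u`. -/
def qubitPart {a a' : ℕ} (V : Matrix (Fin a' × Fin 2) (Fin a) ℂ) (u : Fin 2) :
    Matrix (Fin a') (Fin a) ℂ :=
  V.submatrix (fun i => (i, u)) id

theorem sum_lengthSq_qubitPart {a a' : ℕ} {V : Matrix (Fin a' × Fin 2) (Fin a) ℂ}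
    (hV : IsIsometry V) (w : Fin a → ℂ) : ∑ u, lengthSq (qubitPart V u *ᵥ w) = lengthSq w := by
  rw [← hV.lengthSq_mulVec w]
  simp only [lengthSq]
  rw [Fintype.sum_prod_type, Finset.sum_comm]
  rfl

theorem lengthSq_conjTranspose_qubitPart_le {a a' : ℕ} {V : Matrix (Fin a' × Fin 2) (Fin a) ℂ}
    (hV : IsIsometry V) (u : Fin 2) (w : Fin a' → ℂ) :
    lengthSq ((qubitPart V u)ᴴ *ᵥ w) ≤ lengthSq w :=
  lengthSq_conjTranspose_mulVec_le (fun c => by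
    rw [← sum_lengthSq_qubitPart hV c]
    exact Finset.single_le_sum (f := fun u => lengthSq (qubitPart V u *ᵥ c))
      (fun _ _ => lengthSq_nonneg _) (Finset.mem_univ u)) w

/-- Operators of the party that sends a qubit: if the squared column norm of the family `D` is at
most `r`, that of the products `V_vᴴ D V_u` is at most `2 r`: `V_vᴴ` is a contraction for each of
the two values of `v`, and the `V_u` together form an isometry. Here the squared column norm of a
family `D` is the operator norm of `∑ s, (D s)ᴴ D s`. -/
theorem sum_lengthSq_sender_le {S : Type} [Fintype S] {a a' : ℕ}
    {V : Matrix (Fin a' × Fin 2) (Fin a) ℂ} (hV : IsIsometry V)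
    {D : S → Matrix (Fin a') (Fin a') ℂ} {r : ℝ}
    (hD : ∀ v, ∑ s, lengthSq (D s *ᵥ v) ≤ r * lengthSq v) (w : Fin a → ℂ) :
    ∑ t : S × Fin 2 × Fin 2,
      lengthSq (((qubitPart V t.2.2)ᴴ * D t.1 * qubitPart V t.2.1) *ᵥ w)
        ≤ r * 2 * lengthSq w := by
  calc ∑ t : S × Fin 2 × Fin 2,
        lengthSq (((qubitPart V t.2.2)ᴴ * D t.1 * qubitPart V t.2.1) *ᵥ w)
      ≤ ∑ t : S × Fin 2 × Fin 2, lengthSq (D t.1 *ᵥ (qubitPart V t.2.1 *ᵥ w)) := by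
        refine Finset.sum_le_sum fun t _ => ?_
        rw [← mulVec_mulVec, ← mulVec_mulVec]
        exact lengthSq_conjTranspose_qubitPart_le hV _ _
    _ = ∑ u, 2 * ∑ s, lengthSq (D s *ᵥ (qubitPart V u *ᵥ w)) := by
        simp only [Fintype.sum_prod_type]
        rw [Finset.sum_comm]
        simp [Finset.mul_sum]
    _ ≤ ∑ u, 2 * (r * lengthSq (qubitPart V u *ᵥ w)) := by
        gcongr with u
        exact hD _
    _ = r * 2 * lengthSq w := by
        rw [← sum_lengthSq_qubitPart hV w, ← Finset.mul_sum, ← Finset.mul_sum]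
        ring

/-- Operators of the party that receives a qubit: if the squared column norm of the family `F` is at
most `r`, that of its blocks is at most `2 r`. For fixed `v`, the blocks with second index `v` act
on `w` as `F` acts on `w ⊗ e_v`. -/
theorem sum_lengthSq_receiver_le {S : Type} [Fintype S] {b : ℕ}
    {F : S → Matrix (Fin (b * 2)) (Fin (b * 2)) ℂ} {r : ℝ}
    (hF : ∀ v, ∑ s, lengthSq (F s *ᵥ v) ≤ r * lengthSq v) (w : Fin b → ℂ) :
    ∑ t : S × Fin 2 × Fin 2, lengthSq (qubitBlock (F t.1) t.2.1 t.2.2 *ᵥ w)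
      ≤ r * 2 * lengthSq w := by
  -- the vector `w ⊗ e_v`
  let ext (v : Fin 2) : Fin (b * 2) → ℂ := fun j =>
    if (finProdFinEquiv.symm j).2 = v then w (finProdFinEquiv.symm j).1 else 0
  have hext : ∀ v j u, ext v (finProdFinEquiv (j, u)) = if u = v then w j else 0 := by
    intro v j u
    simp only [ext, Equiv.symm_apply_apply]
  have hlen : ∀ v, lengthSq (ext v) = lengthSq w := by
    intro v
    simp only [lengthSq]
    rw [← finProdFinEquiv.sum_comp, Fintype.sum_prod_type]
    refine Finset.sum_congr rfl fun i _ => ?_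
    rw [Finset.sum_eq_single v (fun u _ hu => by simp [hext, hu]) (by simp), hext, if_pos rfl]
  have hblock : ∀ s v, ∑ u, lengthSq (qubitBlock (F s) u v *ᵥ w) = lengthSq (F s *ᵥ ext v) := by
    intro s v
    simp only [lengthSq]
    rw [← finProdFinEquiv.sum_comp, Fintype.sum_prod_type, Finset.sum_comm]
    refine Finset.sum_congr rfl fun i _ => Finset.sum_congr rfl fun u _ => ?_
    congr 2
    simp only [mulVec, dotProduct]
    rw [← finProdFinEquiv.sum_comp, Fintype.sum_prod_type]
    refine Finset.sum_congr rfl fun j _ => ?_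
    rw [Finset.sum_eq_single v (fun u _ hu => by simp [hext, hu]) (by simp), hext, if_pos rfl]
    rfl
  calc ∑ t : S × Fin 2 × Fin 2, lengthSq (qubitBlock (F t.1) t.2.1 t.2.2 *ᵥ w)
      = ∑ v, ∑ s, lengthSq (F s *ᵥ ext v) := by
        simp only [Fintype.sum_prod_type, ← hblock]
        rw [Finset.sum_comm (γ := Fin 2) (α := S)]
        exact Finset.sum_congr rfl fun s _ => Finset.sum_comm
    _ ≤ ∑ v : Fin 2, r * lengthSq w := by
        refine Finset.sum_le_sum fun v _ => ?_
        rw [← hlen v]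
        exact hF _
    _ = r * 2 * lengthSq w := by
        simp
        ring

/-- After Alice applies `V` and passes her qubit, the observable `Dᴴ ⊗ F` is, in terms of the state
before the move, a sum over the two basis states of the qubit on either side of the inner
product. -/
theorem trace_passToBob {a b : ℕ} {a' : ℕ} (V : Matrix (Fin a' × Fin 2) (Fin a) ℂ)
    (D : Matrix (Fin a') (Fin a') ℂ) (F : Matrix (Fin (b * 2)) (Fin (b * 2)) ℂ)
    (Ψ : Matrix (Fin a) (Fin b) ℂ) :
    ((D * passToBob (V * Ψ))ᴴ * (passToBob (V * Ψ) * Fᵀ)).trace =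
      ∑ u, ∑ v, ((((qubitPart V v)ᴴ * D * qubitPart V u) * Ψ)ᴴ *
        (Ψ * (qubitBlock F u v)ᵀ)).trace := by
  have h1 : ∀ u v, ((((qubitPart V v)ᴴ * D * qubitPart V u) * Ψ)ᴴ *
      (Ψ * (qubitBlock F u v)ᵀ)).trace =
      ((D * (qubitPart V u * Ψ))ᴴ * (qubitPart V v * Ψ * (qubitBlock F u v)ᵀ)).trace := by
    intro u v
    congr 1
    simp only [conjTranspose_mul, conjTranspose_conjTranspose, Matrix.mul_assoc]
  have h2 : ∀ i j u, (D * passToBob (V * Ψ)) i (finProdFinEquiv (j, u)) =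
      (D * (qubitPart V u * Ψ)) i j := by
    intro i j u
    rw [mul_apply, mul_apply]
    refine Finset.sum_congr rfl fun l _ => ?_
    simp [passToBob, qubitPart, mul_apply]
  have h3 : ∀ i j u, (passToBob (V * Ψ) * Fᵀ) i (finProdFinEquiv (j, u)) =
      ∑ v, (qubitPart V v * Ψ * (qubitBlock F u v)ᵀ) i j := by
    intro i j u
    rw [mul_apply, ← finProdFinEquiv.sum_comp, Fintype.sum_prod_type, Finset.sum_comm]
    refine Finset.sum_congr rfl fun v _ => ?_
    rw [mul_apply]
    refine Finset.sum_congr rfl fun l _ => ?_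
    simp [passToBob, qubitPart, mul_apply, qubitBlock]
  simp only [h1, trace_conjTranspose_mul]
  calc _ = ∑ i, ∑ j, ∑ u, ∑ v, star ((D * (qubitPart V u * Ψ)) i j) *
        (qubitPart V v * Ψ * (qubitBlock F u v)ᵀ) i j := by
        refine Finset.sum_congr rfl fun i _ => ?_
        rw [← finProdFinEquiv.sum_comp, Fintype.sum_prod_type]
        simp only [h2, h3, Finset.mul_sum]
    _ = _ := by
        simp only [Finset.sum_comm (γ := Fin b) (α := Fin 2),
          Finset.sum_comm (γ := Fin a') (α := Fin 2)]

/-- The mirror image of `trace_passToBob`, obtained from it by transposing the state. -/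
theorem trace_passToAlice {a b : ℕ} {b' : ℕ} (W : Matrix (Fin b' × Fin 2) (Fin b) ℂ)
    (D : Matrix (Fin (a * 2)) (Fin (a * 2)) ℂ) (F : Matrix (Fin b') (Fin b') ℂ)
    (Ψ : Matrix (Fin a) (Fin b) ℂ) :
    ((D * passToAlice (Ψ * Wᵀ))ᴴ * (passToAlice (Ψ * Wᵀ) * Fᵀ)).trace =
      ∑ u, ∑ v, ((qubitBlock D u v * Ψ)ᴴ *
        (Ψ * ((qubitPart W v)ᴴ * F * qubitPart W u)ᵀ)).trace := by
  have hsymm : ∀ {m n : ℕ} (A B : Matrix (Fin m) (Fin n) ℂ),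
      (Aᴴ * B).trace = star (((Bᵀ)ᴴ * Aᵀ).trace) := by
    intro m n A B
    rw [trace_conjTranspose_mul, trace_conjTranspose_mul, Finset.sum_comm]
    simp [mul_comm]
  have hpass : (passToAlice (Ψ * Wᵀ))ᵀ = passToBob (W * Ψᵀ) := by
    ext i j
    simp [passToAlice, passToBob, mul_apply, mul_comm]
  rw [hsymm, transpose_mul, transpose_mul, transpose_transpose, hpass, trace_passToBob, star_sum]
  refine Finset.sum_congr rfl fun u _ => ?_
  rw [star_sum]
  refine Finset.sum_congr rfl fun v _ => ?_
  rw [hsymm (qubitBlock D u v * Ψ)]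
  simp only [transpose_mul, transpose_transpose, Matrix.mul_assoc]

/-- The observable `Vᴴ diag(g) V` of the final measurement is a contraction. -/
theorem lengthSq_observable_le {a a' : ℕ} {V : Matrix (Fin a') (Fin a) ℂ} (hV : IsIsometry V)
    (g : Fin a' → ℤˣ) (v : Fin a → ℂ) :
    lengthSq ((Vᴴ * diagonal (fun i => (((g i : ℤˣ) : ℤ) : ℂ)) * V) *ᵥ v) ≤ lengthSq v := by
  rw [← mulVec_mulVec, ← mulVec_mulVec]
  refine (hV.lengthSq_conjTranspose_mulVec_le _).trans ?_
  rw [← hV.lengthSq_mulVec v]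
  refine le_of_eq (Finset.sum_congr rfl fun i _ => ?_)
  rw [mulVec_diagonal, norm_mul]
  rcases Int.units_eq_one_or (g i) with h | h <;> simp [h]

/-- A protocol that exchanges `c` qubits measures an observable `∑ s, (D s x)ᴴ ⊗ F s y` on its
initial state, where the squared column norms of both families of operators are at most `2 ^ c`.
The observable is pulled back through the moves, starting from the final measurement. -/
theorem exists_operator_factorization {a b : ℕ} (P : Protocol X Y a b) :
    ∃ (S : Type) (_ : Fintype S) (D : S → X → Matrix (Fin a) (Fin a) ℂ)
      (F : S → Y → Matrix (Fin b) (Fin b) ℂ),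
      (∀ x v, ∑ s, lengthSq (D s x *ᵥ v) ≤ 2 ^ P.cost * lengthSq v) ∧
      (∀ y w, ∑ s, lengthSq (F s y *ᵥ w) ≤ 2 ^ P.cost * lengthSq w) ∧
      ∀ x y Ψ, ((P.correlation x y Ψ : ℝ) : ℂ) =
        ∑ s, ((D s x * Ψ)ᴴ * (Ψ * (F s y)ᵀ)).trace := by
  have key : ∀ (s : ℤˣ) (r : ℝ), ((if s = 1 then r ^ 2 else 0) - if s = -1 then r ^ 2 else 0) =
      ((s : ℤˣ) : ℤ) * r ^ 2 := by
    intro s r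
    rcases Int.units_eq_one_or s with rfl | rfl <;> simp
  induction P with
  | aliceSend a' V hV next ih =>
    obtain ⟨S, _, D, F, hD, hF, h⟩ := ih
    refine ⟨S × Fin 2 × Fin 2, inferInstance,
      fun t x => (qubitPart (V x) t.2.2)ᴴ * D t.1 x * qubitPart (V x) t.2.1,
      fun t y => qubitBlock (F t.1 y) t.2.1 t.2.2, fun x v => ?_, fun y w => ?_,
      fun x y Ψ => ?_⟩
    · rw [cost, pow_succ]
      exact sum_lengthSq_sender_le (hV x) (hD x) v
    · rw [cost, pow_succ]
      exact sum_lengthSq_receiver_le (hF y) w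
    · refine (h x y (passToBob (V x * Ψ))).trans ?_
      simp only [Fintype.sum_prod_type, trace_passToBob]
  | bobSend b' W hW next ih =>
    obtain ⟨S, _, D, F, hD, hF, h⟩ := ih
    refine ⟨S × Fin 2 × Fin 2, inferInstance, fun t x => qubitBlock (D t.1 x) t.2.1 t.2.2,
      fun t y => (qubitPart (W y) t.2.2)ᴴ * F t.1 y * qubitPart (W y) t.2.1,
      fun x v => ?_, fun y w => ?_, fun x y Ψ => ?_⟩
    · rw [cost, pow_succ]
      exact sum_lengthSq_receiver_le (hD x) v
    · rw [cost, pow_succ]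
      exact sum_lengthSq_sender_le (hW y) (hF y) w
    · refine (h x y (passToAlice (Ψ * (W y)ᵀ))).trans ?_
      simp only [Fintype.sum_prod_type, trace_passToAlice]
  | @aliceOutput a b a' V hV g =>
    refine ⟨Unit, inferInstance,
      fun _ x => (V x)ᴴ * diagonal (fun i => (((g i : ℤˣ) : ℤ) : ℂ)) * V x, fun _ _ => 1,
      fun x v => ?_, fun y w => ?_, fun x y Ψ => ?_⟩
    · simpa [cost] using lengthSq_observable_le (hV x) g v
    · simp [cost]
    · have hadj : (((V x)ᴴ * diagonal (fun i => (((g i : ℤˣ) : ℤ) : ℂ)) * V x * Ψ)ᴴ * Ψ) =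
          (diagonal (fun i => (((g i : ℤˣ) : ℤ) : ℂ)) * (V x * Ψ))ᴴ * (V x * Ψ) := by
        simp only [conjTranspose_mul, conjTranspose_conjTranspose, Matrix.mul_assoc]
      simp only [Finset.univ_unique, Finset.sum_const, Finset.card_singleton, one_smul,
        transpose_one, Matrix.mul_one]
      rw [hadj, trace_conjTranspose_mul]
      simp only [correlation, outputProb, ← Finset.sum_sub_distrib, key, diagonal_mul]
      push_cast
      refine Finset.sum_congr rfl fun i _ => Finset.sum_congr rfl fun j _ => ?_
      simp [mul_assoc, RCLike.conj_mul]
  | @bobOutput a b b' W hW g =>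
    refine ⟨Unit, inferInstance, fun _ _ => 1,
      fun _ y => (W y)ᴴ * diagonal (fun i => (((g i : ℤˣ) : ℤ) : ℂ)) * W y,
      fun x v => ?_, fun y w => ?_, fun x y Ψ => ?_⟩
    · simp [cost]
    · simpa [cost] using lengthSq_observable_le (hW y) g w
    · have hadj : (Ψᴴ * (Ψ * ((W y)ᴴ * diagonal (fun i => (((g i : ℤˣ) : ℤ) : ℂ)) * W y)ᵀ)).trace
          = ((Ψ * (W y)ᵀ)ᴴ * ((Ψ * (W y)ᵀ) *
              diagonal (fun i => (((g i : ℤˣ) : ℤ) : ℂ)))).trace := by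
        have hct : ((W y)ᵀ)ᴴ = ((W y)ᴴ)ᵀ := rfl
        rw [conjTranspose_mul, hct, Matrix.mul_assoc ((W y)ᴴ)ᵀ, trace_mul_comm ((W y)ᴴ)ᵀ]
        simp only [transpose_mul, diagonal_transpose, Matrix.mul_assoc]
      simp only [Finset.univ_unique, Finset.sum_const, Finset.card_singleton, one_smul,
        Matrix.one_mul]
      rw [hadj, trace_conjTranspose_mul]
      simp only [correlation, outputProb, ← Finset.sum_sub_distrib, key, mul_diagonal]
      push_cast
      refine Finset.sum_congr rfl fun i _ => Finset.sum_congr rfl fun j _ => ?_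
      rw [← mul_assoc, mul_comm]
      simp [RCLike.conj_mul]

/-- The correlation matrix of a protocol that exchanges `c` qubits is a Gram matrix of real
vectors whose squared lengths are at most `2 ^ c`: its `γ₂` norm is at most `2 ^ c`. -/
theorem exists_gram_correlation {a b : ℕ} (P : Protocol X Y a b) {Ψ : Matrix (Fin a) (Fin b) ℂ}
    (hΨ : ∑ i, ∑ j, ‖Ψ i j‖ ^ 2 = 1) :
    ∃ (K : Type) (_ : Fintype K) (α : X → K → ℝ) (γ : Y → K → ℝ),
      (∀ x, ∑ k, α x k ^ 2 ≤ 2 ^ P.cost) ∧ (∀ y, ∑ k, γ y k ^ 2 ≤ 2 ^ P.cost) ∧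
      ∀ x y, P.correlation x y Ψ = ∑ k, α x k * γ y k := by
  obtain ⟨S, _, D, F, hD, hF, h⟩ := P.exists_operator_factorization
  -- complex amplitudes are split into their real and imaginary parts
  have hsplit : ∀ z : ℂ, z.re ^ 2 + z.im ^ 2 = ‖z‖ ^ 2 := fun z => by
    rw [Complex.sq_norm, Complex.normSq_apply]; ring
  refine ⟨S × Fin a × Fin b × Bool, inferInstance,
    fun x t => cond t.2.2.2 ((D t.1 x * Ψ) t.2.1 t.2.2.1).re ((D t.1 x * Ψ) t.2.1 t.2.2.1).im,
    fun y t => cond t.2.2.2 ((Ψ * (F t.1 y)ᵀ) t.2.1 t.2.2.1).re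
      ((Ψ * (F t.1 y)ᵀ) t.2.1 t.2.2.1).im, fun x => ?_, fun y => ?_, fun x y => ?_⟩
  · simp only [Fintype.sum_prod_type, Fintype.sum_bool, cond_true, cond_false, hsplit,
      sum_norm_sq_mul]
    rw [Finset.sum_comm]
    refine (Finset.sum_le_sum fun j _ => hD x (Ψ.col j)).trans ?_
    rw [← Finset.mul_sum]
    simp only [lengthSq, col_apply]
    rw [Finset.sum_comm, hΨ, mul_one]
  · simp only [Fintype.sum_prod_type, Fintype.sum_bool, cond_true, cond_false, hsplit,
      sum_norm_sq_mul_transpose]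
    rw [Finset.sum_comm]
    refine (Finset.sum_le_sum fun i _ => hF y (Ψ i)).trans ?_
    rw [← Finset.mul_sum]
    simp only [lengthSq]
    rw [hΨ, mul_one]
  · have h' := congrArg Complex.re (h x y Ψ)
    rw [Complex.ofReal_re] at h'
    rw [h']
    simp only [trace_conjTranspose_mul]
    simp [Fintype.sum_prod_type, Complex.mul_re]

end Protocol

/-! ### A singular value estimate -/

section Spectral

variable {X Y : Type*} [Fintype X] [Fintype Y] [DecidableEq X]

/-- An orthogonal change of basis on the side of `X`, to eigenvectors of `R_f R_fᵀ`, turns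
`R_f` into a matrix with orthogonal rows of squared lengths `|X| |Y| λ i`. -/
theorem exists_orthogonal_mul_rectangle [Nonempty X] [Nonempty Y] (f : X → Y → ℤˣ) :
    ∃ U : Matrix X X ℝ, U * Uᵀ = 1 ∧
      (Uᵀ * rectangle f) * (Uᵀ * rectangle f)ᵀ =
        diagonal fun i => ((Fintype.card X : ℝ) * Fintype.card Y) * spectrumOf f i := by
  have hA := marginalDensity_isHermitian f
  set N : ℝ := (Fintype.card X : ℝ) * Fintype.card Y with hN
  have hN0 : N ≠ 0 := by positivity
  set U : Matrix X X ℝ := (hA.eigenvectorUnitary : Matrix X X ℝ) with hU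
  have h1 : U * Uᵀ = 1 := by
    have h := Unitary.coe_mul_star_self hA.eigenvectorUnitary
    rwa [Unitary.coe_star, star_eq_conjTranspose, conjTranspose_eq_transpose_of_trivial] at h
  have h2 : Uᵀ * U = 1 := by
    have h := Unitary.coe_star_mul_self hA.eigenvectorUnitary
    rwa [star_eq_conjTranspose, conjTranspose_eq_transpose_of_trivial] at h
  refine ⟨U, h1, ?_⟩
  have hR : rectangle f * (rectangle f)ᵀ = N • marginalDensity f := by
    rw [marginalDensity, smul_smul, ← hN, mul_one_div_cancel hN0, one_smul]
  have hdiag : Uᵀ * marginalDensity f * U = diagonal (spectrumOf f) := by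
    have h := hA.spectral_theorem
    rw [Unitary.conjStarAlgAut_apply, star_eq_conjTranspose,
      conjTranspose_eq_transpose_of_trivial, ← hU] at h
    rw [h, ← Matrix.mul_assoc, ← Matrix.mul_assoc, h2, Matrix.one_mul, Matrix.mul_assoc, h2,
      Matrix.mul_one]
    rfl
  rw [transpose_mul, transpose_transpose, Matrix.mul_assoc, ← Matrix.mul_assoc (rectangle f), hR,
    Matrix.smul_mul, Matrix.mul_smul, ← Matrix.mul_assoc, hdiag, ← diagonal_smul]
  rfl

theorem spectrumOf_nonneg (f : X → Y → ℤˣ) (i : X) : 0 ≤ spectrumOf f i := by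
  refine PosSemidef.eigenvalues_nonneg (A := marginalDensity f) ?_ i
  refine PosSemidef.smul ?_ (by positivity)
  rw [← conjTranspose_eq_transpose_of_trivial]
  exact posSemidef_self_mul_conjTranspose _

/-- A contraction does not increase the Frobenius norm. -/
theorem sum_sq_mul_le {ι κ ν : Type*} [Fintype ι] [Fintype κ] [Fintype ν] {V : Matrix κ ι ℝ}
    (hV : ∀ c, lengthSq (V *ᵥ c) ≤ lengthSq c) (M : Matrix ι ν ℝ) :
    ∑ i, ∑ j, (V * M) i j ^ 2 ≤ ∑ i, ∑ j, M i j ^ 2 := by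
  have h := sum_norm_sq_mul V M
  simp only [Real.norm_eq_abs, sq_abs] at h
  rw [h, Finset.sum_comm]
  refine Finset.sum_le_sum fun j _ => (hV _).trans ?_
  simp [lengthSq]

/-- The weights `D i` are the absolute values of the normalized diagonal entries of `C` in the
singular bases of `R_f`. The bound `|C x y| ≤ 1` on the entries becomes an `ℓ²` bound on `D`, and
the Gram representation of `C`, by the Cauchy-Schwarz inequality, an `ℓ¹` bound. -/
theorem exists_weights [Nonempty X] [Nonempty Y] (f : X → Y → ℤˣ) {K : Type*} [Fintype K]
    {C : X → Y → ℝ} {α : X → K → ℝ} {γ : Y → K → ℝ} {T : ℝ}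
    (hC : ∀ x y, |C x y| ≤ 1) (hα : ∀ x, ∑ k, α x k ^ 2 ≤ T) (hγ : ∀ y, ∑ k, γ y k ^ 2 ≤ T)
    (hCαγ : ∀ x y, C x y = ∑ k, α x k * γ y k) :
    ∃ D : X → ℝ, (∀ i, 0 ≤ D i) ∧ ∑ i, D i ≤ T ∧ ∑ i, D i ^ 2 ≤ 1 ∧
      ∑ x, ∑ y, uniformInput x y * (rectangle f x y * C x y) ≤
        ∑ i, D i * √(spectrumOf f i) := by
  obtain ⟨U, hU1, hW⟩ := exists_orthogonal_mul_rectangle f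
  set N : ℝ := (Fintype.card X : ℝ) * Fintype.card Y with hN
  have hN0 : 0 < N := by positivity
  have hlam := spectrumOf_nonneg f
  set lam := spectrumOf f
  set W : Matrix X Y ℝ := Uᵀ * rectangle f with hWdef
  -- `q i` normalizes row `i` of `W`; it is `0` where that row vanishes
  set q : X → ℝ := fun i => (√(N * lam i))⁻¹ with hq
  set Z : Matrix X Y ℝ := diagonal q * W with hZ
  have hZZ : Z * Zᵀ = diagonal fun i => q i * (N * lam i) * q i := by
    rw [hZ, transpose_mul, diagonal_transpose, Matrix.mul_assoc, ← Matrix.mul_assoc W, hW,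
      diagonal_mul_diagonal, diagonal_mul_diagonal]
    simp only [mul_assoc]
  have hχ : ∀ i, q i * (N * lam i) * q i ≤ 1 := by
    intro i
    have hs := Real.mul_self_sqrt (mul_nonneg hN0.le (hlam i))
    rcases eq_or_ne (√(N * lam i)) 0 with h | h
    · simp [hq, h]
    · refine le_of_eq ?_
      simp only [hq]
      rw [mul_right_comm, ← mul_inv, hs]
      refine inv_mul_cancel₀ fun h0 => h ?_
      rw [h0, Real.sqrt_zero]
  have hWZ : ∀ i y, W i y = √(N * lam i) * Z i y := by
    intro i y
    simp only [hZ, diagonal_mul, hq]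
    rcases eq_or_ne (√(N * lam i)) 0 with h | h
    -- a row of `W` of length zero vanishes
    · have h0 := congrFun (congrFun hW i) i
      rw [diagonal_apply_eq, (Real.sqrt_eq_zero (mul_nonneg hN0.le (hlam i))).1 h, mul_apply] at h0
      have := (Finset.sum_eq_zero_iff_of_nonneg
        (fun y _ => mul_self_nonneg (W i y))).1 h0 y (Finset.mem_univ y)
      simpa [h] using this
    · rw [mul_inv_cancel_left₀ h]
  have hZt : ∀ c, lengthSq (Zᵀ *ᵥ c) ≤ lengthSq c := by
    intro c
    have : lengthSq (Zᵀ *ᵥ c) = ∑ i, q i * (N * lam i) * q i * c i ^ 2 := by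
      rw [lengthSq_eq_re, star_trivial, RCLike.re_to_real, dotProduct_mulVec, vecMul_mulVec,
        transpose_transpose, hZZ, dotProduct_comm]
      simp only [vecMul_diagonal, dotProduct]
      exact Finset.sum_congr rfl fun i _ => by ring
    rw [this, lengthSq]
    refine Finset.sum_le_sum fun i _ => ?_
    rw [Real.norm_eq_abs, sq_abs]
    exact mul_le_of_le_one_left (sq_nonneg _) (hχ i)
  have hZc : ∀ b, lengthSq (Z *ᵥ b) ≤ lengthSq b := by
    intro b
    simpa using lengthSq_conjTranspose_mulVec_le hZt b
  have hUc : ∀ c, lengthSq (Uᵀ *ᵥ c) ≤ lengthSq c := by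
    intro c
    refine le_of_eq ?_
    rw [lengthSq_eq_re, lengthSq_eq_re, star_trivial, star_trivial, dotProduct_mulVec,
      vecMul_mulVec, transpose_transpose, hU1, vecMul_one]
  have hZrow : ∀ i, ∑ y, Z i y ^ 2 ≤ 1 := by
    intro i
    have h0 := congrFun (congrFun hZZ i) i
    rw [diagonal_apply_eq, mul_apply] at h0
    simp only [sq]
    exact h0.trans_le (hχ i)
  set B : Matrix X Y ℝ := Uᵀ * of C with hB
  -- the diagonal entry of `C` at the `i`-th left and right singular vectors of `R_f`
  set d : X → ℝ := fun i => ∑ y, Z i y * B i y with hd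
  have hd' : ∀ i, d i = ∑ k, (Uᵀ * of α) i k * (Z * of γ) i k := by
    intro i
    have hCm : of C = of α * (of γ)ᵀ := by
      ext x y
      simp [mul_apply, hCαγ]
    have h1 : d i = (Z * Bᵀ) i i := by simp [hd, mul_apply]
    have h2 : (∑ k, (Uᵀ * of α) i k * (Z * of γ) i k) =
        (Z * of γ * (Uᵀ * of α)ᵀ) i i := by
      rw [mul_apply (M := Z * of γ)]
      exact Finset.sum_congr rfl fun k _ => mul_comm _ _
    rw [h1, h2, hB, hCm]
    simp only [transpose_mul, transpose_transpose, Matrix.mul_assoc]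
  have hsN : √N * √N = N := Real.mul_self_sqrt hN0.le
  have hsN0 : 0 < √N := Real.sqrt_pos.2 hN0
  have hT : 0 ≤ T :=
    (Finset.sum_nonneg fun k _ => sq_nonneg _).trans (hα (Classical.arbitrary X))
  refine ⟨fun i => |d i| / √N, fun i => by positivity, ?_, ?_, ?_⟩
  · rw [← Finset.sum_div, div_le_iff₀ hsN0]
    have hA1 : ∑ i, ∑ k, (Uᵀ * of α) i k ^ 2 ≤ Fintype.card X * T := by
      refine (sum_sq_mul_le hUc _).trans ((Finset.sum_le_sum fun x _ => hα x).trans ?_)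
      simp
    have hA2 : ∑ i, ∑ k, (Z * of γ) i k ^ 2 ≤ Fintype.card Y * T := by
      refine (sum_sq_mul_le hZc _).trans ((Finset.sum_le_sum fun x _ => hγ x).trans ?_)
      simp
    calc ∑ i, |d i|
        ≤ ∑ i, √(∑ k, (Uᵀ * of α) i k ^ 2) * √(∑ k, (Z * of γ) i k ^ 2) := by
          refine Finset.sum_le_sum fun i _ => ?_
          rw [← Real.sqrt_mul (Finset.sum_nonneg fun k _ => sq_nonneg _), hd']
          exact Real.abs_le_sqrt (Finset.sum_mul_sq_le_sq_mul_sq _ _ _)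
      _ ≤ √(∑ i, ∑ k, (Uᵀ * of α) i k ^ 2) * √(∑ i, ∑ k, (Z * of γ) i k ^ 2) :=
          Real.sum_sqrt_mul_sqrt_le _ (fun i => Finset.sum_nonneg fun k _ => sq_nonneg _)
            (fun i => Finset.sum_nonneg fun k _ => sq_nonneg _)
      _ ≤ √(Fintype.card X * T) * √(Fintype.card Y * T) := by gcongr
      _ = T * √N := by
          rw [← Real.sqrt_mul (by positivity), show (Fintype.card X * T * (Fintype.card Y * T) : ℝ)
            = T ^ 2 * N by rw [hN]; ring, Real.sqrt_mul (by positivity), Real.sqrt_sq hT]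
  · have hCsq : ∑ i, ∑ y, B i y ^ 2 ≤ N := by
      refine (sum_sq_mul_le hUc _).trans ?_
      calc ∑ x, ∑ y, of C x y ^ 2 ≤ ∑ x : X, ∑ y : Y, (1 : ℝ) := by
            refine Finset.sum_le_sum fun x _ => Finset.sum_le_sum fun y _ => ?_
            exact (sq_le_one_iff_abs_le_one _).2 (hC x y)
        _ = N := by simp [hN]
    simp only [div_pow, sq_abs]
    rw [← Finset.sum_div, Real.sq_sqrt hN0.le, div_le_one hN0]
    refine (Finset.sum_le_sum fun i _ => ?_).trans hCsq
    refine (Finset.sum_mul_sq_le_sq_mul_sq _ _ _).trans ?_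
    exact mul_le_of_le_one_left (Finset.sum_nonneg fun y _ => sq_nonneg _) (hZrow i)
  · have hsum : ∑ x, ∑ y, rectangle f x y * C x y = ∑ i, √(N * lam i) * d i := by
      have h1 : ∑ i, √(N * lam i) * d i = (Wᵀ * B).trace := by
        rw [trace]
        simp only [diag_apply, mul_apply (M := Wᵀ), transpose_apply]
        rw [Finset.sum_comm]
        refine Finset.sum_congr rfl fun i _ => ?_
        rw [hd, Finset.mul_sum]
        refine Finset.sum_congr rfl fun y _ => ?_
        rw [hWZ]
        ring
      rw [h1, hWdef, hB, transpose_mul, transpose_transpose, Matrix.mul_assoc,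
        ← Matrix.mul_assoc U, hU1, Matrix.one_mul, trace, Finset.sum_comm]
      simp [mul_apply]
    have h2 : ∀ x y, (uniformInput x y : ℝ) * (rectangle f x y * C x y) =
        N⁻¹ * (rectangle f x y * C x y) := by
      intro x y
      rw [uniformInput, ← hN, one_div]
    simp only [h2, ← Finset.mul_sum]
    rw [hsum, Finset.mul_sum]
    refine Finset.sum_le_sum fun i _ => ?_
    rw [Real.sqrt_mul hN0.le]
    have h3 : N⁻¹ * (√N * √(lam i) * d i) = d i / √N * √(lam i) := by
      nth_rewrite 1 [← hsN]
      field_simp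
    rw [h3]
    gcongr
    exact le_abs_self _

end Spectral

/-! ### Hölder's inequality and the entropy bounds -/

/-- Interpolation between an `ℓ¹` and an `ℓ²` bound on the weights `D`. -/
theorem sum_mul_sqrt_le {ι : Type*} [Fintype ι] {D lam : ι → ℝ} {T β : ℝ} (hβ : 1 < β)
    (hD : ∀ i, 0 ≤ D i) (hlam : ∀ i, 0 ≤ lam i) (hD1 : ∑ i, D i ≤ T) (hD2 : ∑ i, D i ^ 2 ≤ 1) :
    ∑ i, D i * √(lam i) ≤ T ^ (1 - β⁻¹) * (∑ i, lam i ^ β) ^ (1 / (2 * β)) := by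
  have hβ0 : 0 < β := by linarith
  have hβ1 : 0 ≤ 1 - β⁻¹ := by
    rw [sub_nonneg]
    exact inv_le_one_of_one_le₀ hβ.le
  have hsum0 : 0 ≤ ∑ i, lam i ^ β := Finset.sum_nonneg fun i _ => Real.rpow_nonneg (hlam i) _
  have hcs : ∑ i, D i * √(lam i) ^ β ≤ √(∑ i, lam i ^ β) := by
    refine (Real.sum_mul_le_sqrt_mul_sqrt _ _ _).trans ?_
    have h : ∀ i, (√(lam i) ^ β) ^ 2 = lam i ^ β := by
      intro i
      rw [← Real.rpow_natCast, ← Real.rpow_mul (Real.sqrt_nonneg _), mul_comm, Real.rpow_mul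
        (Real.sqrt_nonneg _), Real.rpow_natCast, Real.sq_sqrt (hlam i)]
    simp only [h]
    exact mul_le_of_le_one_left (Real.sqrt_nonneg _) (Real.sqrt_le_one.2 hD2)
  refine (Real.inner_le_weight_mul_Lp_of_nonneg _ hβ.le D _ hD
    fun i => Real.sqrt_nonneg _).trans ?_
  have hnn : 0 ≤ ∑ i, D i * √(lam i) ^ β := Finset.sum_nonneg fun i _ =>
    mul_nonneg (hD i) (Real.rpow_nonneg (Real.sqrt_nonneg _) _)
  have hnn' : 0 ≤ ∑ i, D i := Finset.sum_nonneg fun i _ => hD i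
  have hT : 0 ≤ T := hnn'.trans hD1
  calc _ ≤ T ^ (1 - β⁻¹) * √(∑ i, lam i ^ β) ^ β⁻¹ := by gcongr
    _ = _ := by
      rw [Real.sqrt_eq_rpow, ← Real.rpow_mul hsum0]
      congr 2
      field_simp

/-- Logarithmic form of the estimate by Hölder's inequality. If the power sum of `lam` were zero,
the estimate would contradict `0 < δ`, so the logarithms below are never junk values. -/
theorem renyiEntropy_bound {ι : Type*} [Fintype ι] {lam : ι → ℝ} {β δ : ℝ} {c : ℕ} (hβ : 1 < β)
    (hlam : ∀ i, 0 ≤ lam i) (hδ : 0 < δ)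
    (h : δ ≤ ((2 : ℝ) ^ c) ^ (1 - β⁻¹) * (∑ i, lam i ^ β) ^ (1 / (2 * β))) :
    1 / 2 * renyiEntropy β lam + β / (β - 1) * Real.logb 2 δ ≤ c := by
  have hβ0 : 0 < β := by linarith
  have hβ1 : 0 < β - 1 := by linarith
  have hsum : 0 < ∑ i, lam i ^ β := by
    refine lt_of_le_of_ne (Finset.sum_nonneg fun i _ => Real.rpow_nonneg (hlam i) _) fun h0 => ?_
    rw [← h0, Real.zero_rpow (by positivity), mul_zero] at h
    linarith
  have hlog := Real.logb_le_logb_of_le (b := 2) (by norm_num) hδ h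
  rw [Real.logb_mul (by positivity) (by positivity), Real.logb_rpow_eq_mul_logb_of_pos
    (by positivity), Real.logb_rpow_eq_mul_logb_of_pos hsum, Real.logb_pow,
    Real.logb_self_eq_one (by norm_num), mul_one] at hlog
  rw [renyiEntropy]
  set L := Real.logb 2 (∑ i, lam i ^ β)
  have h1 := mul_le_mul_of_nonneg_left hlog (show 0 ≤ β / (β - 1) by positivity)
  have h2 : β / (β - 1) * ((1 - β⁻¹) * c + 1 / (2 * β) * L) = c - 1 / 2 * (1 / (1 - β) * L) := by
    have : 1 - β ≠ 0 := by linarith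
    have hne := hβ1.ne'
    rw [show 1 / (1 - β) = -(1 / (β - 1)) by rw [← neg_sub, one_div, one_div, inv_neg]]
    field_simp
    ring
  linarith

/-- The case of infinite order; the supremum is positive because `δ` is. -/
theorem renyiEntropyInfty_bound {ι : Type*} [Finite ι] [Nonempty ι] {lam : ι → ℝ} {δ : ℝ} {c : ℕ}
    (hδ : 0 < δ) (h : δ ≤ 2 ^ c * √(⨆ i, lam i)) :
    1 / 2 * renyiEntropyInfty lam + Real.logb 2 δ ≤ c := by
  have hsup : 0 < ⨆ i, lam i := by
    by_contra hneg
    rw [Real.sqrt_eq_zero_of_nonpos (not_lt.1 hneg), mul_zero] at h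
    linarith
  have hlog := Real.logb_le_logb_of_le (b := 2) (by norm_num) hδ h
  rw [Real.sqrt_eq_rpow, Real.logb_mul (by positivity) (by positivity),
    Real.logb_rpow_eq_mul_logb_of_pos hsup, Real.logb_pow, Real.logb_self_eq_one (by norm_num),
    mul_one] at hlog
  rw [renyiEntropyInfty]
  linarith

/-! ### Lower bounds for the complexities -/

section Complexity

variable {X Y : Type*} [Fintype X] [Fintype Y]

theorem sum_uniformInput [Nonempty X] [Nonempty Y] :
    ∑ x : X, ∑ y : Y, (uniformInput x y : ℝ) = 1 := by
  have h : (Fintype.card X : ℝ) * Fintype.card Y ≠ 0 := by positivity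
  simp only [uniformInput, Finset.sum_const, Finset.card_univ, nsmul_eq_mul, ← mul_assoc]
  exact mul_one_div_cancel h

/-- A protocol that succeeds on every input succeeds on average. -/
theorem eprDistComplexity_le_eprComplexity [Nonempty X] [Nonempty Y] (f : X → Y → ℤˣ) (ε : ℝ) :
    eprDistComplexity uniformInput f ε ≤ eprComplexity f ε := by
  refine sInf_le_sInf ?_
  rintro q ⟨k, hk, P, hP, rfl⟩
  refine ⟨k, hk, P, ?_, rfl⟩
  calc 1 - ε = ∑ x : X, ∑ y : Y, uniformInput x y * (1 - ε) := by
        simp only [← Finset.sum_mul]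
        rw [sum_uniformInput, one_mul]
    _ ≤ _ := by
        refine Finset.sum_le_sum fun x _ => Finset.sum_le_sum fun y _ => ?_
        refine mul_le_mul_of_nonneg_left (hP x y) ?_
        rw [uniformInput]
        positivity

/-- A lower bound for the cost of every protocol is a lower bound for the complexity. -/
theorem le_eprDistComplexity {μ : X → Y → ℝ} {f : X → Y → ℤˣ} {ε r : ℝ}
    (h : ∀ k : ℕ, 0 < k → ∀ P : Protocol X Y k k,
      1 - ε ≤ ∑ x, ∑ y, μ x y * P.outputProb x y (f x y) (maxEntangled k) → r ≤ P.cost) :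
    (r : EReal) ≤ ((eprDistComplexity μ f ε : ENNReal) : EReal) := by
  rcases Set.eq_empty_or_nonempty {q : ℕ∞ | ∃ k : ℕ, 0 < k ∧ ∃ P : Protocol X Y k k,
    1 - ε ≤ ∑ x, ∑ y, μ x y * P.outputProb x y (f x y) (maxEntangled k) ∧ q = (P.cost : ℕ∞)}
    with he | hne
  · rw [eprDistComplexity, he]
    simp
  · obtain ⟨k, hk, P, hP, hq⟩ := csInf_mem hne
    rw [eprDistComplexity, hq]
    have hcost : (((P.cost : ℕ∞) : ENNReal) : EReal) = ((P.cost : ℝ) : EReal) := by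
      rw [ENat.toENNReal_coe, ← ENNReal.coe_natCast]
      rfl
    rw [hcost]
    exact EReal.coe_le_coe_iff.2 (h k hk P hP)

/-- The advantage `1 - 2 ε` of a protocol of cost `c` is at most the pairing of the singular values
of the normalized rectangle with weights that are bounded by `2 ^ c` in `ℓ¹` and by `1` in `ℓ²`. -/
theorem exists_weights_of_protocol [DecidableEq X] [Nonempty X] [Nonempty Y] {f : X → Y → ℤˣ}
    {ε : ℝ} {k : ℕ} (hk : 0 < k) (P : Protocol X Y k k)
    (hP : 1 - ε ≤ ∑ x, ∑ y, uniformInput x y * P.outputProb x y (f x y) (maxEntangled k)) :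
    ∃ D : X → ℝ, (∀ i, 0 ≤ D i) ∧ ∑ i, D i ≤ 2 ^ P.cost ∧ ∑ i, D i ^ 2 ≤ 1 ∧
      1 - 2 * ε ≤ ∑ i, D i * √(spectrumOf f i) := by
  have hΨ := sum_norm_sq_maxEntangled hk
  obtain ⟨K, _, α, γ, hα, hγ, hαγ⟩ := P.exists_gram_correlation hΨ
  obtain ⟨D, hD, hD1, hD2, hDs⟩ :=
    exists_weights f (fun x y => P.abs_correlation_le x y hΨ) hα hγ hαγ
  refine ⟨D, hD, hD1, hD2, le_trans ?_ hDs⟩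
  have h : ∀ x y, uniformInput x y * (rectangle f x y * P.correlation x y (maxEntangled k)) =
      2 * (uniformInput x y * P.outputProb x y (f x y) (maxEntangled k)) - uniformInput x y := by
    intro x y
    rw [rectangle, of_apply, P.sign_mul_correlation x y (f x y) hΨ]
    ring
  simp only [h, Finset.sum_sub_distrib, ← Finset.mul_sum]
  rw [sum_uniformInput]
  linarith

end Complexity

end QuantumCC

theorem mainTheorem2 {X Y : Type*} [Fintype X] [Fintype Y] [DecidableEq X]
    [Nonempty X] [Nonempty Y] (f : X → Y → ℤˣ) (ε : ℝ) (hε₀ : 0 ≤ ε) (hε₁ : ε < 1 / 2) :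
    (∀ β : ℝ, 1 < β →
      ((1 / 2 * QuantumCC.renyiEntropy β (QuantumCC.spectrumOf f)
          + β / (β - 1) * Real.logb 2 (1 - 2 * ε) : ℝ) : EReal)
        ≤ ((QuantumCC.eprComplexity f ε : ENNReal) : EReal) ∧
      ((1 / 2 * QuantumCC.renyiEntropy β (QuantumCC.spectrumOf f)
          + β / (β - 1) * Real.logb 2 (1 - 2 * ε) : ℝ) : EReal)
        ≤ ((QuantumCC.eprDistComplexity QuantumCC.uniformInput f ε : ENNReal) : EReal)) ∧
    ((1 / 2 * QuantumCC.renyiEntropyInfty (QuantumCC.spectrumOf f)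
        + Real.logb 2 (1 - 2 * ε) : ℝ) : EReal)
      ≤ ((QuantumCC.eprComplexity f ε : ENNReal) : EReal) ∧
    ((1 / 2 * QuantumCC.renyiEntropyInfty (QuantumCC.spectrumOf f)
        + Real.logb 2 (1 - 2 * ε) : ℝ) : EReal)
      ≤ ((QuantumCC.eprDistComplexity QuantumCC.uniformInput f ε : ENNReal) : EReal) := by
  have hδ : 0 < 1 - 2 * ε := by linarith
  have hlam := QuantumCC.spectrumOf_nonneg f
  have hmono : ((QuantumCC.eprDistComplexity QuantumCC.uniformInput f ε : ENNReal) : EReal) ≤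
      ((QuantumCC.eprComplexity f ε : ENNReal) : EReal) := by
    rw [EReal.coe_ennreal_le_coe_ennreal_iff, ENat.toENNReal_le]
    exact QuantumCC.eprDistComplexity_le_eprComplexity f ε
  have hfin : ∀ β : ℝ, 1 < β → _ := fun β hβ =>
    QuantumCC.le_eprDistComplexity (μ := QuantumCC.uniformInput) (f := f) (ε := ε)
      fun k hk P hP => by
        obtain ⟨D, hD, hD1, hD2, hDs⟩ := QuantumCC.exists_weights_of_protocol hk P hP
        exact QuantumCC.renyiEntropy_bound hβ hlam hδ
          (hDs.trans (QuantumCC.sum_mul_sqrt_le hβ hD hlam hD1 hD2))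
  have hinf := QuantumCC.le_eprDistComplexity (μ := QuantumCC.uniformInput) (f := f) (ε := ε)
      fun k hk P hP => by
        obtain ⟨D, hD, hD1, hD2, hDs⟩ := QuantumCC.exists_weights_of_protocol hk P hP
        refine QuantumCC.renyiEntropyInfty_bound (lam := QuantumCC.spectrumOf f) hδ
          (hDs.trans ?_)
        calc ∑ i, D i * √(QuantumCC.spectrumOf f i)
            ≤ ∑ i, D i * √(⨆ i, QuantumCC.spectrumOf f i) := by
              refine Finset.sum_le_sum fun i _ => mul_le_mul_of_nonneg_left ?_ (hD i)
              exact Real.sqrt_le_sqrt (le_ciSup (Set.finite_range _).bddAbove i)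
          _ ≤ 2 ^ P.cost * √(⨆ i, QuantumCC.spectrumOf f i) := by
              rw [← Finset.sum_mul]
              gcongr
  exact ⟨fun β hβ => ⟨(hfin β hβ).trans hmono, hfin β hβ⟩, hinf.trans hmono, hinf⟩
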